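/- Let $K$ be a birational involution of $\mathbb P_n(\mathbb C)$, written in homogeneous coordinates as $n+1$ forms of one degree without common factor, with $K(K(x))=\phi(x)\,x$ for a polynomial $\phi\neq 0$. Let $r\ge 0$. For $C=(C_1,\dots,C_r)\in PGL(n+1,\mathbb C)^r$ let $\Gamma_C$ be the collineated group of birational transformations of $\mathbb P_n$ generated by the $\nu=r+1$ involutions $K$ and $I_k=C_k^{-1}KC_k$ $(1\le k\le r)$; for $\nu=2$ it is generated by $K$ and $I=C^{-1}KC$. Embed $PGL(n+1,\mathbb C)$ in $\mathbb P^{(n+1)^2-1}$ as the complement of $\{\det=0\}$, and call a subset of $(\mathbb P^{(n+1)^2-1})^r$ quasi-projective if it is the difference of two Zariski closed subsets (zero loci of multihomogeneous polynomials). A one-cocycle $a$ assigns to every word $g$ in the generators (with the composed, not reduced, homogeneous components) a polynomial $a(g,x)$ such that $a(g_1g_2,x)=a(g_1,g_2x)\,a(g_2,x)$; a form $\sigma$ is $a$-covariant if $\sigma(gx)=a(g,x)\sigma(x)$ for all $g$. Fix a degree $m\ge 0$. 1. The set of all $C\in PGL(n+1,\mathbb C)^r$ such that $\Gamma_C$ admits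 a non-constant invariant rational function $\Delta$ of degree at most $m$ (that is, $\Delta=P/Q$ with $P,Q$ linearly independent forms of degree $m$, possibly with common factors, and $\Delta(gx)=\Delta(x)$ for all $g\in\Gamma_C$) is quasi-projective. So is the set of all $C$ such that, for some one-cocycle $a$, the $a$-covariant forms of degree $m$ span a linear system of projective dimension at least $1$. 2. The conditions are algebraic rank conditions on the parameters of $C$. Namely, let $a,b$ be polynomials in $x$, let $L^K$ be the space of forms $P$ of degree $m$ with $P(Kx)=a(x)P(x)$, and for $C\in GL(n+1,\mathbb C)$ and $I=C^{-1}KC$ let $L^I$ be the space of forms $P$ of degree $m$ with $P(Ix)=b(Cx)P(x)$. There are a basis of the space of forms of degree $m$ whose first $k=\dim L^K$ members are a basis of $L^K$, and a matrix $E$ with $t$ rows (both independent of $C$), whose entries are homogeneous polynomials of degree $m$ in the entries of $C$, such that for every $C\in GL(n+1,\mathbb C)$ the rows of $E(C)$ are the coordinates in that basis of the members of a basis of $L^I$, and $$\dim(L^K\cap L^I)+\operatorname{rank}B(C)=k+t,\qquad B(C)=\begin{pmatrix}\mathbf 1\;\;\mathbf 0\\ E(C)\end{pmatrix}.$$ In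 particular $\dim(L^K\cap L^I)\ge 2$ if and only if $\operatorname{rank}B(C)\le k+t-2$. -/

import Mathlib

open scoped LinearAlgebra.Projectivization

noncomputable section

namespace Collineated

/-- Polynomials in the homogeneous coordinates `x_0, …, x_n` of `ℙ_n`. -/
abbrev Poly (n : ℕ) := MvPolynomial (Fin (n + 1)) ℂ

/-- A polynomial self-map of `ℂ^{n+1}` (a rational self-map of `ℙ_n`, written in homogeneous
coordinates, when the entries are forms of one degree which do not all vanish). -/
abbrev PolyMap (n : ℕ) := Fin (n + 1) → Poly n

/-- Substitution: `subst F P` is the polynomial `P(F(x))`. -/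
def subst {n : ℕ} (F : PolyMap n) (P : Poly n) : Poly n := MvPolynomial.aeval F P

/-- The composition `x ↦ F(G(x))`. -/
def comp {n : ℕ} (F G : PolyMap n) : PolyMap n := fun i => subst G (F i)

/-- The linear map `x ↦ M x`. -/
def linMap {n : ℕ} (M : Matrix (Fin (n + 1)) (Fin (n + 1)) ℂ) : PolyMap n :=
  fun i => ∑ j, MvPolynomial.C (M i j) * MvPolynomial.X j

/-- A birational involution of `ℙ_n` in reduced homogeneous coordinates: `n+1` forms of the same
degree without common factor, whose square is multiplication by a nonzero polynomial `φ`. -/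
structure BirationalInvolution (n : ℕ) where
  /-- the homogeneous components -/
  map : PolyMap n
  /-- the degree of the involution -/
  degree : ℕ
  isHomogeneous : ∀ i, (map i).IsHomogeneous degree
  reduced : ∀ g : Poly n, (∀ i, g ∣ map i) → IsUnit g
  /-- the characteristic polynomial of the involution -/
  phi : Poly n
  phi_ne_zero : phi ≠ 0
  involutive : ∀ i, comp map map i = phi * MvPolynomial.X i

/-- The conjugate `C⁻¹ K C` of `K` by the collineation `C`. -/
def conj {n : ℕ} (K : BirationalInvolution n) (C : GL (Fin (n + 1)) ℂ) : PolyMap n :=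
  comp (linMap (C⁻¹ : GL (Fin (n + 1)) ℂ).val) (comp K.map (linMap C.val))

/-- The `r + 1` generators of the collineated group: `K` itself (index `none`), and
`I_k = C_k⁻¹ K C_k` for `k < r` (index `some k`). -/
def gen {n r : ℕ} (K : BirationalInvolution n) (C : Fin r → GL (Fin (n + 1)) ℂ) :
    Option (Fin r) → PolyMap n
  | none => K.map
  | some k => conj K (C k)

/-- The map `I_{k_1} ∘ ⋯ ∘ I_{k_l}` given by a word in the generators. As the generators are
involutions of `ℙ_n`, the birational transformations given by words are exactly the elements of
the group `Γ` that the generators generate. -/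
def realize {n r : ℕ} (K : BirationalInvolution n) (C : Fin r → GL (Fin (n + 1)) ℂ) :
    List (Option (Fin r)) → PolyMap n
  | [] => MvPolynomial.X
  | k :: w => comp (gen K C k) (realize K C w)

/-- `Γ` has a non-constant invariant rational function `Δ = P / Q` of degree at most `m`:
`P` and `Q` are linearly independent forms of degree `m` (common factors are allowed), and
`Δ(g x) = Δ(x)`, written without denominators, for all `g` in `Γ`. (A common factor of the
components of a representative of `g` cancels from this equation.) -/
def HasInvariant {n r : ℕ} (K : BirationalInvolution n) (m : ℕ)
    (C : Fin r → GL (Fin (n + 1)) ℂ) : Prop :=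
  ∃ P Q : Poly n, P.IsHomogeneous m ∧ Q.IsHomogeneous m ∧ LinearIndependent ℂ ![P, Q] ∧
    ∀ w, subst (realize K C w) P * Q = subst (realize K C w) Q * P

/-- The one-cocycle condition `a(g₁ g₂, x) = a(g₁, g₂ x) a(g₂, x)`. The value `a(g, ·)` depends on
the homogeneous representative of `g` (the squares of the generators act as multiplication by
polynomials), so `g` runs through words. -/
def IsCocycle {n r : ℕ} (K : BirationalInvolution n) (C : Fin r → GL (Fin (n + 1)) ℂ)
    (a : List (Option (Fin r)) → Poly n) : Prop :=
  ∀ u v, a (u ++ v) = subst (realize K C v) (a u) * a v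

/-- The space of all forms `P` of degree `m` with `P(F(x)) = a(x) P(x)`. -/
def covariantSystem {n : ℕ} (F : PolyMap n) (m : ℕ) (a : Poly n) :
    Submodule ℂ (MvPolynomial.homogeneousSubmodule (Fin (n + 1)) ℂ m) where
  carrier := {P | subst F P.val = a * P.val}
  zero_mem' := by simp [subst]
  add_mem' := by
    intro P Q hP hQ
    simp only [Set.mem_ofPred_eq, subst, Submodule.coe_add, map_add, mul_add] at *
    rw [hP, hQ]
  smul_mem' := by
    intro c P hP
    simp only [Set.mem_ofPred_eq, subst, Submodule.coe_smul, map_smul, mul_smul_comm] at *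
    rw [hP]

/-- `Γ` has an `a`-covariant linear system of degree `m` and projective dimension at least `1`,
for some one-cocycle `a`. -/
def HasCovariantSystem {n r : ℕ} (K : BirationalInvolution n) (m : ℕ)
    (C : Fin r → GL (Fin (n + 1)) ℂ) : Prop :=
  ∃ a : List (Option (Fin r)) → Poly n, IsCocycle K C a ∧
    2 ≤ Module.finrank ℂ
      (⨅ w, covariantSystem (realize K C w) m (a w) :
        Submodule ℂ (MvPolynomial.homogeneousSubmodule (Fin (n + 1)) ℂ m))

/-- The product of `r` copies of `ℙ^{(n+1)² - 1}`, the projective space of `(n+1) × (n+1)`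
matrices. It contains `PGL(n+1, ℂ)^r` as the open set of tuples of invertible matrices. -/
abbrev MatrixSpace (n r : ℕ) := Fin r → ℙ ℂ (Matrix (Fin (n + 1)) (Fin (n + 1)) ℂ)

/-- The point of `PGL(n+1, ℂ)^r` given by `r` invertible matrices. -/
def toPoint {n r : ℕ} (C : Fin r → GL (Fin (n + 1)) ℂ) : MatrixSpace n r :=
  fun k => Projectivization.mk ℂ (C k).val (C k).ne_zero

/-- Polynomials in the entries of `r` matrices. -/
abbrev EntryPoly (n r : ℕ) := MvPolynomial (Fin r × Fin (n + 1) × Fin (n + 1)) ℂ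

/-- Multihomogeneous: homogeneous in the entries of each of the `r` matrices. For `r = 1` this is
homogeneity. -/
def IsMultihomogeneous {n r : ℕ} (f : EntryPoly n r) : Prop :=
  ∃ d : Fin r → ℕ, MvPolynomial.IsWeightedHomogeneous
    (fun x : Fin r × Fin (n + 1) × Fin (n + 1) => (Pi.single x.1 1 : Fin r → ℕ)) f d

/-- The common zero locus of a set of multihomogeneous polynomials. -/
def zeroLocus {n r : ℕ} (S : Set (EntryPoly n r)) : Set (MatrixSpace n r) :=
  {p | ∀ f ∈ S, MvPolynomial.eval (fun x => (p x.1).rep x.2.1 x.2.2) f = 0}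

/-- Quasi-projective: the difference of two Zariski closed subsets. -/
def IsQuasiProjective {n r : ℕ} (Z : Set (MatrixSpace n r)) : Prop :=
  ∃ S T : Set (EntryPoly n r), (∀ f ∈ S, IsMultihomogeneous f) ∧
    (∀ f ∈ T, IsMultihomogeneous f) ∧ Z = zeroLocus S \ zeroLocus T

/-- The value at `C` of a matrix of polynomials in the entries of `C`. -/
def evalAt {n : ℕ} {α β : Type*}
    (E : Matrix α β (MvPolynomial (Fin (n + 1) × Fin (n + 1)) ℂ))
    (C : GL (Fin (n + 1)) ℂ) : Matrix α β ℂ :=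
  E.map (MvPolynomial.eval fun x => C.val x.1 x.2)

end Collineated

end

/-! Part 1 turns each existence statement into finitely many determinantal conditions. If `P / Q` is
invariant, cancel the gcd: coprimality of the remaining `p`, `q` forces `p(gx) = b p(x)` and `q(gx)
= b q(x)` with one common factor `b` for each generator `g`. So an invariant of degree at most `m`
is the same as a covariant pencil of some degree `d ≤ m` (`hasInvariant_iff`). A multiplier system
is determined by its values on generators, and each of these, carried back to `K` by `C_k`, is a
multiplier `a` of `K`. From `a(x) a(Kx) = φ(x)^d` there are only finitely many such `a`
(`finite_multipliers`), and they do not depend on `C`. For fixed multipliers the covariant forms are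
the kernel of a linear map whose entries become multihomogeneous in `C` once `C_k⁻¹` is replaced by
the adjugate; a kernel of dimension at least 2 means that minors vanish. Finite unions are closed,
and removing the determinant locus leaves a quasi-projective set. In part 2, `P ↦ P(Cx)` carries a
fixed basis of the `b`-covariant forms of `K` to a basis of `L^I` with coordinates of degree `m` in
`C`. The rows of `B(C)` span `L^K + L^I`, so the formula is the dimension formula for sums and
intersections. -/

namespace Collineated

open MvPolynomial

/-! ### Rank conditions as vanishing of minors -/

section LinearAlgebra

/-- A family of vectors in `κ → 𝕜` whose span is everything contains a basis, so that linearly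
independent rows have a nonvanishing maximal minor. -/
theorem exists_det_ne_zero_of_linearIndependent {𝕜 κ ι : Type*} [Field 𝕜] [Fintype κ]
    [DecidableEq κ] {v : κ → ι → 𝕜} (hv : LinearIndependent 𝕜 v) :
    ∃ ρ : κ → ι, (Matrix.of fun i j => v i (ρ j)).det ≠ 0 := by
  -- The columns span: a functional vanishing on every column would be a linear relation between the
  -- rows.
  have hspan : Submodule.span 𝕜 (Set.range fun (x : ι) (i : κ) => v i x) = ⊤ := by
    by_contra hne
    obtain ⟨f, hf, hle⟩ := Submodule.exists_le_ker_of_lt_top _ (lt_top_iff_ne_top.2 hne)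
    refine hf ((Pi.basisFun 𝕜 κ).ext fun i => ?_)
    have h := Fintype.linearIndependent_iff.1 hv (fun i => f (Pi.single i 1)) (by
      ext x
      have h0 : f (fun i => v i x) = 0 := hle (Submodule.subset_span ⟨x, rfl⟩)
      rw [LinearMap.pi_apply_eq_sum_univ f] at h0
      rw [Finset.sum_apply, Pi.zero_apply, ← h0]
      refine Finset.sum_congr rfl fun i _ => ?_
      rw [Pi.smul_apply, smul_eq_mul, smul_eq_mul, mul_comm]
      congr 2
      ext j
      simp [Pi.single_apply, eq_comm])
    simpa using h i
  obtain ⟨f, hf, hfs, hfi⟩ :=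
    Submodule.exists_fun_fin_finrank_span_eq 𝕜 (Set.range fun (x : ι) (i : κ) => v i x)
  have hcard : Module.finrank 𝕜
      (Submodule.span 𝕜 (Set.range fun (x : ι) (i : κ) => v i x)) = Fintype.card κ := by
    rw [hspan, finrank_top, Module.finrank_fintype_fun_eq_card]
  choose ρ hρ using hf
  let e : κ ≃ Fin (Module.finrank 𝕜
      (Submodule.span 𝕜 (Set.range fun (x : ι) (i : κ) => v i x))) :=
    (Fintype.equivFin κ).trans (finCongr hcard.symm)
  refine ⟨fun j => ρ (e j), fun hdet => ?_⟩
  obtain ⟨c, hc, h0⟩ := Matrix.exists_mulVec_eq_zero_iff.2 hdet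
  refine hc ?_
  have hli : LinearIndependent 𝕜 (fun j => f (e j)) := hfi.comp e e.injective
  have := Fintype.linearIndependent_iff.1 hli c (by
    ext i
    have := congrFun h0 i
    simp only [Matrix.mulVec, dotProduct, Matrix.of_apply, Pi.zero_apply] at this
    rw [Finset.sum_apply]
    simp only [Pi.smul_apply, smul_eq_mul, Pi.zero_apply]
    rw [← this]
    refine Finset.sum_congr rfl fun j _ => ?_
    rw [mul_comm, ← hρ (e j)])
  exact funext this

/-- The rank of a linear map is less than `s` if and only if all its `s`-minors vanish. -/
theorem finrank_range_lt_iff {𝕜 V ι κ : Type*} [Field 𝕜] [AddCommGroup V] [Module 𝕜 V]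
    [Finite κ] (e : Module.Basis κ 𝕜 V) (f : V →ₗ[𝕜] (ι → 𝕜)) (s : ℕ) :
    Module.finrank 𝕜 (LinearMap.range f) < s ↔ ∀ (γ : Fin s → κ) (ρ : Fin s → ι),
      (Matrix.of fun i j => f (e (γ i)) (ρ j)).det = 0 := by
  classical
  have : Module.Finite 𝕜 V := Module.Finite.of_basis e
  constructor
  · intro hlt γ ρ
    rw [← Matrix.exists_vecMul_eq_zero_iff]
    by_contra hcon
    refine absurd hlt (not_lt.2 ?_)
    have hli : LinearIndependent 𝕜 (fun i : Fin s =>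
        (⟨f (e (γ i)), LinearMap.mem_range_self f _⟩ : LinearMap.range f)) := by
      rw [Fintype.linearIndependent_iff]
      intro c hc
      by_contra hne
      refine hcon ⟨c, fun h => hne fun i => congrFun h i, ?_⟩
      ext j
      have := congrFun (congrArg Subtype.val hc) (ρ j)
      simpa [Matrix.vecMul, dotProduct, Finset.sum_apply] using this
    simpa using hli.fintype_card_le_finrank
  · intro h
    by_contra hge
    have hrange : Submodule.span 𝕜 (Set.range fun k => f (e k)) = LinearMap.range f := by
      rw [LinearMap.range_eq_map, ← e.span_eq, Submodule.map_span, ← Set.range_comp]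
      rfl
    have : Module.Finite 𝕜 (Submodule.span 𝕜 (Set.range fun k => f (e k))) := by
      rw [hrange]; infer_instance
    obtain ⟨g, hg, -, hgi⟩ :=
      Submodule.exists_fun_fin_finrank_span_eq 𝕜 (Set.range fun k => f (e k))
    choose γ hγ using hg
    rw [← hrange, not_lt] at hge
    have hli : LinearIndependent 𝕜 (fun i : Fin s => f (e (γ (Fin.castLE hge i)))) := by
      have hfg : (fun k => f (e (γ k))) = g := funext hγ
      rw [← hfg] at hgi
      exact hgi.comp _ (Fin.castLE_injective hge)
    obtain ⟨ρ, hρ⟩ := exists_det_ne_zero_of_linearIndependent hli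
    exact hρ (h _ ρ)

/-- Rank-nullity: the kernel has dimension at least 2 exactly when the rank is less than `N - 1`.
For `N ≤ 1` the only minor is the empty determinant 1, and both sides are false. -/
theorem two_le_finrank_ker_iff {𝕜 V ι : Type*} [Field 𝕜] [AddCommGroup V] [Module 𝕜 V] {N : ℕ}
    (e : Module.Basis (Fin N) 𝕜 V) (f : V →ₗ[𝕜] (ι → 𝕜)) :
    2 ≤ Module.finrank 𝕜 (LinearMap.ker f) ↔ ∀ (γ : Fin (N - 1) → Fin N) (ρ : Fin (N - 1) → ι),
      (Matrix.of fun i j => f (e (γ i)) (ρ j)).det = 0 := by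
  have : Module.Finite 𝕜 V := Module.Finite.of_basis e
  rw [← finrank_range_lt_iff]
  have h := LinearMap.finrank_range_add_finrank_ker f
  rw [Module.finrank_eq_card_basis e, Fintype.card_fin] at h
  omega

end LinearAlgebra

/-! ### Homogeneity of factors -/

section Homogeneous

/-- A family of substitutions scaled by a common factor. -/
theorem aeval_mul_of_isHomogeneous {σ R A : Type*} [Fintype σ] [CommSemiring R] [CommSemiring A]
    [Algebra R A] {P : MvPolynomial σ R} {d : ℕ} (hP : P.IsHomogeneous d) (c : A) (f : σ → A) :
    aeval (fun i => c * f i) P = c ^ d * aeval f P := by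
  rw [aeval_def, aeval_def, eval₂_eq', eval₂_eq', Finset.mul_sum]
  refine Finset.sum_congr rfl fun s hs => ?_
  simp_rw [mul_pow]
  have hd : s.degree = d := (hP.degree_eq_sum_deg_support hs).symm
  rw [Finset.prod_mul_distrib, Finset.prod_pow_eq_pow_sum, ← Finsupp.degree_eq_sum, hd]
  ring

/-- The homogeneous components of `P` are the coefficients of `P(tx)` as a polynomial in `t`. -/
theorem coeff_aeval_X_mul_C {σ R : Type*} [CommSemiring R] (P : MvPolynomial σ R) (d : ℕ) :
    (aeval (fun i => (Polynomial.X * Polynomial.C (X i) : Polynomial (MvPolynomial σ R))) P).coeff d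
      = homogeneousComponent d P := by
  classical
  induction P using MvPolynomial.induction_on' with
  | monomial s a =>
    have h : aeval (fun i => (Polynomial.X * Polynomial.C (X i) :
        Polynomial (MvPolynomial σ R))) (monomial s a) =
        Polynomial.C (monomial s a) * Polynomial.X ^ s.degree := by
      rw [aeval_monomial, Finsupp.prod]
      simp_rw [mul_pow]
      rw [Finset.prod_mul_distrib, Finset.prod_pow_eq_pow_sum, monomial_eq, Finsupp.prod]
      simp only [map_mul, map_prod, map_pow, Finsupp.degree]
      rw [IsScalarTower.algebraMap_apply R (MvPolynomial σ R) (Polynomial (MvPolynomial σ R))]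
      simp only [algebraMap_eq, Polynomial.algebraMap_eq]
      ring_nf
      rfl
    rw [h, Polynomial.coeff_C_mul, Polynomial.coeff_X_pow,
      homogeneousComponent_of_mem (isHomogeneous_monomial a rfl)]
    split_ifs <;> simp_all
  | add p q hp hq => rw [map_add, Polynomial.coeff_add, hp, hq, map_add]

/-- Factors of a nonzero form are forms. Under `F ↦ F(tx)` the product becomes a monomial in `t`, so
both the degrees and the trailing degrees of the factors add up to `m`; hence each factor is itself
a monomial in `t`. -/
theorem isHomogeneous_of_mul {σ R : Type*} [CommRing R] [IsDomain R] {P Q : MvPolynomial σ R}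
    {m : ℕ} (h : (P * Q).IsHomogeneous m) (h0 : P * Q ≠ 0) :
    ∃ d, d ≤ m ∧ P.IsHomogeneous d ∧ Q.IsHomogeneous (m - d) := by
  classical
  set Φ : MvPolynomial σ R →ₐ[R] Polynomial (MvPolynomial σ R) :=
    aeval (fun i => (Polynomial.X * Polynomial.C (X i) : Polynomial (MvPolynomial σ R))) with hΦ
  have hcoeff : ∀ F d, (Φ F).coeff d = homogeneousComponent d F := coeff_aeval_X_mul_C
  have hne : ∀ F, F ≠ 0 → Φ F ≠ 0 := by
    intro F hF hz
    refine hF ?_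
    rw [← sum_homogeneousComponent F]
    exact Finset.sum_eq_zero fun i _ => by rw [← hcoeff, hz, Polynomial.coeff_zero]
  have hhom : ∀ F d, (∀ j, j ≠ d → (Φ F).coeff j = 0) → F.IsHomogeneous d := by
    intro F d hF s hs
    by_contra hne'
    refine hs ?_
    have := congrArg (coeff s) (hF s.degree (by
      rwa [Finsupp.degree_eq_weight_one]))
    rw [hcoeff, coeff_homogeneousComponent] at this
    simpa using this
  have hPQ : Φ P * Φ Q = Polynomial.C (P * Q) * Polynomial.X ^ m := by
    rw [← map_mul]
    ext1 d
    rw [hcoeff, homogeneousComponent_of_mem h, Polynomial.coeff_C_mul, Polynomial.coeff_X_pow]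
    split_ifs <;> simp_all
  have hP := hne P (left_ne_zero_of_mul h0)
  have hQ := hne Q (right_ne_zero_of_mul h0)
  have hdeg : (Φ P).natDegree + (Φ Q).natDegree = m := by
    rw [← Polynomial.natDegree_mul hP hQ, hPQ, Polynomial.natDegree_C_mul_X_pow _ _ h0]
  have htr : (Φ P).natTrailingDegree + (Φ Q).natTrailingDegree = m := by
    rw [← Polynomial.natTrailingDegree_mul hP hQ, hPQ, Polynomial.C_mul_X_pow_eq_monomial,
      Polynomial.natTrailingDegree_monomial h0]
  have h1 := Polynomial.natTrailingDegree_le_natDegree (Φ P)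
  have h2 := Polynomial.natTrailingDegree_le_natDegree (Φ Q)
  have hmono : ∀ F : Polynomial (MvPolynomial σ R), F.natTrailingDegree = F.natDegree →
      ∀ j, j ≠ F.natDegree → F.coeff j = 0 := by
    intro F hF j hj
    rcases lt_or_gt_of_ne hj with hlt | hgt
    · exact Polynomial.coeff_eq_zero_of_lt_natTrailingDegree (hF ▸ hlt)
    · exact Polynomial.coeff_eq_zero_of_natDegree_lt hgt
  refine ⟨(Φ P).natDegree, by omega, hhom P _ (hmono _ (by omega)), hhom Q _ ?_⟩
  have : m - (Φ P).natDegree = (Φ Q).natDegree := by omega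
  rw [this]
  exact hmono _ (by omega)

end Homogeneous

/-! ### Degrees in the parameters of coefficients and determinants -/

section GenericSubstitution

variable {σ τ M : Type*} [AddCommMonoid M]

/-- All coefficients of `F` are weighted homogeneous of degree `d`. -/
def HasHomogeneousCoeffs (w : τ → M) (d : M) (F : MvPolynomial σ (MvPolynomial τ ℂ)) : Prop :=
  ∀ s, (F.coeff s).IsWeightedHomogeneous w d

variable {w : τ → M} {d d' : M} {F G : MvPolynomial σ (MvPolynomial τ ℂ)}

theorem HasHomogeneousCoeffs.sum {ι : Type*} {s : Finset ι}
    {f : ι → MvPolynomial σ (MvPolynomial τ ℂ)} (h : ∀ i, HasHomogeneousCoeffs w d (f i)) :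
    HasHomogeneousCoeffs w d (∑ i ∈ s, f i) := by
  intro t
  rw [coeff_sum]
  exact IsWeightedHomogeneous.sum _ _ _ fun i _ => h i t

theorem HasHomogeneousCoeffs.sub (hF : HasHomogeneousCoeffs w d F)
    (hG : HasHomogeneousCoeffs w d G) : HasHomogeneousCoeffs w d (F - G) := by
  intro t
  rw [coeff_sub]
  exact (hF t).sub (hG t)

theorem HasHomogeneousCoeffs.mul (hF : HasHomogeneousCoeffs w d F)
    (hG : HasHomogeneousCoeffs w d' G) : HasHomogeneousCoeffs w (d + d') (F * G) := by
  classical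
  intro t
  rw [coeff_mul]
  exact IsWeightedHomogeneous.sum _ _ _ fun i _ => (hF _).mul (hG _)

theorem hasHomogeneousCoeffs_C {c : MvPolynomial τ ℂ} (hc : c.IsWeightedHomogeneous w d) :
    HasHomogeneousCoeffs (σ := σ) w d (C c) := by
  classical
  intro t
  rw [coeff_C]
  split_ifs
  · exact hc
  · exact isWeightedHomogeneous_zero _ _ _

theorem hasHomogeneousCoeffs_map (P : MvPolynomial σ ℂ) :
    HasHomogeneousCoeffs w 0 (map (C : ℂ →+* MvPolynomial τ ℂ) P) := by
  intro t
  rw [coeff_map]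
  exact isWeightedHomogeneous_C _ _

theorem hasHomogeneousCoeffs_X (i : σ) :
    HasHomogeneousCoeffs w 0 (X i : MvPolynomial σ (MvPolynomial τ ℂ)) := by
  simpa using hasHomogeneousCoeffs_map (τ := τ) (w := w) (X i)

theorem HasHomogeneousCoeffs.pow (hF : HasHomogeneousCoeffs w d F) (n : ℕ) :
    HasHomogeneousCoeffs w (n • d) (F ^ n) := by
  induction n with
  | zero =>
    rw [pow_zero, zero_smul, ← C_1]
    exact hasHomogeneousCoeffs_C (isWeightedHomogeneous_one _ _)
  | succ n ih =>
    rw [pow_succ, succ_nsmul]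
    exact ih.mul hF

theorem HasHomogeneousCoeffs.prod {ι : Type*} {s : Finset ι} {δ : ι → M}
    {f : ι → MvPolynomial σ (MvPolynomial τ ℂ)} (h : ∀ i, HasHomogeneousCoeffs w (δ i) (f i)) :
    HasHomogeneousCoeffs w (∑ i ∈ s, δ i) (∏ i ∈ s, f i) := by
  classical
  induction s using Finset.induction_on with
  | empty =>
    rw [Finset.prod_empty, Finset.sum_empty, ← C_1]
    exact hasHomogeneousCoeffs_C (isWeightedHomogeneous_one _ _)
  | insert i s hi ih =>
    rw [Finset.prod_insert hi, Finset.sum_insert hi]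
    exact (h i).mul ih

/-- Substituting forms of degree `d` in the parameters into a form of degree `m` yields
coefficients which are forms of degree `m d` in the parameters. -/
theorem HasHomogeneousCoeffs.aeval {ρ : Type*} [Fintype ρ] {P : MvPolynomial ρ ℂ} {m : ℕ}
    (hP : P.IsHomogeneous m) {f : ρ → MvPolynomial σ (MvPolynomial τ ℂ)}
    (hf : ∀ i, HasHomogeneousCoeffs w d (f i)) :
    HasHomogeneousCoeffs w (m • d) (MvPolynomial.aeval f P) := by
  rw [aeval_def, eval₂_eq', ← Finset.sum_coe_sort]
  refine HasHomogeneousCoeffs.sum fun s => ?_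
  have h1 := (hasHomogeneousCoeffs_C (σ := σ) (isWeightedHomogeneous_C w (P.coeff s))).mul
    (HasHomogeneousCoeffs.prod (s := Finset.univ) fun i => (hf i).pow (s.1 i))
  have hd : s.1.degree = m := (hP.degree_eq_sum_deg_support s.2).symm
  rwa [zero_add, ← Finset.sum_smul, ← Finsupp.degree_eq_sum, hd] at h1

/-- A determinant whose `i`-th row consists of forms of degree `δ i`. -/
theorem isWeightedHomogeneous_det {κ : Type*} [Fintype κ] [DecidableEq κ] {δ : κ → M}
    {A : Matrix κ κ (MvPolynomial τ ℂ)} (h : ∀ i j, (A i j).IsWeightedHomogeneous w (δ j)) :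
    A.det.IsWeightedHomogeneous w (∑ i, δ i) := by
  rw [Matrix.det_apply]
  refine IsWeightedHomogeneous.sum _ _ _ fun p _ => ?_
  -- The factor `A (p i) i` lies in column `i`, so its degree is `δ i` for every permutation `p`.
  have : (∏ i, A (p i) i).IsWeightedHomogeneous w (∑ i, δ i) :=
    IsWeightedHomogeneous.prod _ _ _ fun i _ => h _ _
  rcases Int.units_eq_one_or (Equiv.Perm.sign p) with hp | hp <;> rw [hp]
  · simpa using this
  · simpa using this.neg

/-- An adjugate entry is a determinant with one row replaced by a unit vector. After transposition
the replaced column has degree 0 and the other `n` columns have degree `d`. -/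
theorem isWeightedHomogeneous_adjugate {n : ℕ} {A : Matrix (Fin (n + 1)) (Fin (n + 1))
    (MvPolynomial τ ℂ)} (h : ∀ i j, (A i j).IsWeightedHomogeneous w d) (i j : Fin (n + 1)) :
    (A.adjugate i j).IsWeightedHomogeneous w (n • d) := by
  rw [Matrix.adjugate_apply, ← Matrix.det_transpose]
  have : n • d = ∑ k : Fin (n + 1), if k = j then 0 else d := by
    rw [Finset.sum_ite]
    simp [Finset.filter_ne', Finset.card_erase_of_mem]
  rw [this]
  refine isWeightedHomogeneous_det fun k l => ?_
  rw [Matrix.transpose_apply, Matrix.updateRow_apply]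
  split_ifs with hl
  · rw [Pi.single_apply]
    split_ifs
    · exact isWeightedHomogeneous_one _ _
    · exact isWeightedHomogeneous_zero _ _ _
  · exact h _ _

end GenericSubstitution

/-- A submodule has dimension at least two if and only if it contains two independent vectors. -/
theorem two_le_finrank_iff {𝕜 V : Type*} [Field 𝕜] [AddCommGroup V] [Module 𝕜 V]
    [Module.Finite 𝕜 V] (W : Submodule 𝕜 V) :
    2 ≤ Module.finrank 𝕜 W ↔ ∃ x ∈ W, ∃ y ∈ W, LinearIndependent 𝕜 ![x, y] := by
  constructor
  · intro h
    obtain ⟨v, hv⟩ := exists_linearIndependent_of_le_finrank h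
    refine ⟨_, (v 0).2, _, (v 1).2, ?_⟩
    have hv' := hv.map' W.subtype W.ker_subtype
    have heq : W.subtype ∘ v = ![(v 0).1, (v 1).1] := by
      ext i
      fin_cases i <;> rfl
    rwa [heq] at hv'
  · rintro ⟨x, hx, y, hy, h⟩
    have h' : LinearIndependent 𝕜 ![(⟨x, hx⟩ : W), ⟨y, hy⟩] := by
      refine LinearIndependent.of_comp W.subtype ?_
      have heq : W.subtype ∘ ![(⟨x, hx⟩ : W), ⟨y, hy⟩] = ![x, y] := by
        ext i
        fin_cases i <;> rfl
      rwa [heq]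
    simpa using h'.fintype_card_le_finrank

/-! ### Substitution calculus and collineations -/

section Substitution

variable {n : ℕ}

@[simp] theorem subst_X (F : PolyMap n) (i : Fin (n + 1)) : subst F (X i) = F i := aeval_X _ _

@[simp] theorem subst_C (F : PolyMap n) (c : ℂ) : subst F (C c) = C c := aeval_C _ _

@[simp] theorem subst_zero (F : PolyMap n) : subst F 0 = 0 := map_zero _

@[simp] theorem subst_mul (F : PolyMap n) (P Q : Poly n) :
    subst F (P * Q) = subst F P * subst F Q := map_mul _ _ _

@[simp] theorem subst_sum {ι : Type*} (F : PolyMap n) (s : Finset ι) (P : ι → Poly n) :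
    subst F (∑ i ∈ s, P i) = ∑ i ∈ s, subst F (P i) := map_sum _ _ _

@[simp] theorem subst_identity (P : Poly n) : subst X P = P := aeval_X_left_apply P

theorem subst_comp (F G : PolyMap n) (P : Poly n) : subst (comp F G) P = subst G (subst F P) :=
  (comp_aeval_apply F (aeval G) P).symm

theorem comp_assoc (F G H : PolyMap n) : comp (comp F G) H = comp F (comp G H) := by
  funext i
  exact (subst_comp G H (F i)).symm

theorem comp_identity (F : PolyMap n) : comp F X = F := by
  funext i
  exact subst_identity (F i)

theorem comp_linMap_apply (M : Matrix (Fin (n + 1)) (Fin (n + 1)) ℂ) (F : PolyMap n)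
    (i : Fin (n + 1)) : comp (linMap M) F i = ∑ j, C (M i j) * F j := by
  simp [comp, linMap]

theorem comp_linMap_linMap (M N : Matrix (Fin (n + 1)) (Fin (n + 1)) ℂ) :
    comp (linMap M) (linMap N) = linMap (M * N) := by
  funext i
  rw [comp_linMap_apply]
  simp only [linMap, Matrix.mul_apply, Finset.mul_sum, map_sum, map_mul, Finset.sum_mul]
  rw [Finset.sum_comm]
  simp only [mul_assoc]

@[simp] theorem linMap_one : linMap (1 : Matrix (Fin (n + 1)) (Fin (n + 1)) ℂ) = X := by
  funext i
  simp [linMap, Matrix.one_apply, apply_ite C]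

theorem subst_linMap_inv (c : GL (Fin (n + 1)) ℂ) (P : Poly n) :
    subst (linMap c.val) (subst (linMap (c⁻¹).val) P) = P := by
  rw [← subst_comp, comp_linMap_linMap, ← Units.val_mul, inv_mul_cancel, Units.val_one, linMap_one,
    subst_identity]

theorem subst_inv_linMap (c : GL (Fin (n + 1)) ℂ) (P : Poly n) :
    subst (linMap (c⁻¹).val) (subst (linMap c.val) P) = P := by
  simpa using subst_linMap_inv c⁻¹ P

theorem subst_linMap_injective (c : GL (Fin (n + 1)) ℂ) :
    Function.Injective (subst (linMap c.val)) :=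
  Function.LeftInverse.injective (subst_inv_linMap c)

theorem isHomogeneous_linMap (M : Matrix (Fin (n + 1)) (Fin (n + 1)) ℂ) (i : Fin (n + 1)) :
    (linMap M i).IsHomogeneous 1 :=
  IsHomogeneous.sum _ _ _ fun _ _ => isHomogeneous_C_mul_X _ _

theorem isHomogeneous_subst_linMap (M : Matrix (Fin (n + 1)) (Fin (n + 1)) ℂ) {P : Poly n} {d : ℕ}
    (hP : P.IsHomogeneous d) : (subst (linMap M) P).IsHomogeneous d := by
  have := hP.aeval (linMap M) (isHomogeneous_linMap M)
  rwa [one_mul] at this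

theorem subst_smul_map {P : Poly n} {d : ℕ} (hP : P.IsHomogeneous d) (c : Poly n) (F : PolyMap n) :
    subst (fun i => c * F i) P = c ^ d * subst F P := aeval_mul_of_isHomogeneous hP c F

theorem subst_conj (K : BirationalInvolution n) (c : GL (Fin (n + 1)) ℂ) (P : Poly n) :
    subst (conj K c) P = subst (linMap c.val) (subst K.map (subst (linMap (c⁻¹).val) P)) := by
  rw [conj, subst_comp, subst_comp]

theorem mem_covariantSystem {F : PolyMap n} {m : ℕ} {a : Poly n}
    {P : homogeneousSubmodule (Fin (n + 1)) ℂ m} :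
    P ∈ covariantSystem F m a ↔ subst F P.val = a * P.val := Iff.rfl

/-- `P` is covariant under `C⁻¹ K C` if and only if `P ∘ C⁻¹` is covariant under `K`. -/
theorem subst_conj_eq_iff (K : BirationalInvolution n) (c : GL (Fin (n + 1)) ℂ) (a P : Poly n) :
    subst (conj K c) P = subst (linMap c.val) a * P ↔
      subst K.map (subst (linMap (c⁻¹).val) P) = a * subst (linMap (c⁻¹).val) P := by
  rw [subst_conj, ← (subst_linMap_injective c).eq_iff (b := a * _), subst_mul, subst_linMap_inv]

instance (m : ℕ) : Module.Finite ℂ (homogeneousSubmodule (Fin (n + 1)) ℂ m) :=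
  Module.Finite.iff_fg.2 (homogeneousSubmodule_fg _ _ m)

end Substitution

/-! ### Involutions and finiteness of their multipliers -/

section Involution

variable {n : ℕ}

/-- `F ∘ F` is multiplication by the nonzero polynomial `φ`. -/
def SquaresTo (F : PolyMap n) (φ : Poly n) : Prop :=
  φ ≠ 0 ∧ ∀ i, comp F F i = φ * X i

theorem BirationalInvolution.squaresTo (K : BirationalInvolution n) : SquaresTo K.map K.phi :=
  ⟨K.phi_ne_zero, K.involutive⟩

theorem SquaresTo.subst_subst {F : PolyMap n} {φ P : Poly n} (h : SquaresTo F φ) {d : ℕ}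
    (hP : P.IsHomogeneous d) : subst F (subst F P) = φ ^ d * P := by
  rw [← subst_comp, show comp F F = fun i => φ * X i from funext h.2, subst_smul_map hP,
    subst_identity]

/-- Substituting `F` twice gives `φ ^ d * P`, which is nonzero. -/
theorem SquaresTo.subst_ne_zero {F : PolyMap n} {φ P : Poly n} (h : SquaresTo F φ) {d : ℕ}
    (hP : P.IsHomogeneous d) (h0 : P ≠ 0) : subst F P ≠ 0 := by
  intro hz
  have := h.subst_subst hP
  rw [hz, subst_zero] at this
  exact mul_ne_zero (pow_ne_zero _ h.1) h0 this.symm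

theorem squaresTo_conj (K : BirationalInvolution n) (c : GL (Fin (n + 1)) ℂ) :
    SquaresTo (conj K c) (subst (linMap c.val) K.phi) := by
  refine ⟨fun h => K.phi_ne_zero (subst_linMap_injective c (h.trans (subst_zero _).symm)),
    fun i => ?_⟩
  have h1 : comp (conj K c) (conj K c) i = subst (conj K c) (subst (conj K c) (X i)) := by
    rw [subst_X]; rfl
  have h2 : (subst (linMap (c⁻¹).val) (X i : Poly n)).IsHomogeneous 1 :=
    isHomogeneous_subst_linMap _ (isHomogeneous_X _ _)
  rw [h1, subst_conj, subst_conj, subst_inv_linMap, K.squaresTo.subst_subst h2, subst_mul,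
    subst_linMap_inv, pow_one]

theorem exists_squaresTo_gen {r : ℕ} (K : BirationalInvolution n) (c : Fin r → GL (Fin (n + 1)) ℂ) :
    ∀ g, ∃ φ, SquaresTo (gen K c g) φ
  | none => ⟨_, K.squaresTo⟩
  | some k => ⟨_, squaresTo_conj K (c k)⟩

/-- The multipliers `a` of nonzero forms `P` of degree `d` with `P(Kx) = a(x) P(x)`. -/
def multipliers (K : BirationalInvolution n) (d : ℕ) : Set (Poly n) :=
  {a | ∃ P : Poly n, P.IsHomogeneous d ∧ P ≠ 0 ∧ subst K.map P = a * P}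

/-- Compute `P(K(Kx))` in two ways and cancel `P`. -/
theorem mul_subst_of_mem_multipliers {K : BirationalInvolution n} {d : ℕ} {a : Poly n}
    (ha : a ∈ multipliers K d) : a * subst K.map a = K.phi ^ d := by
  obtain ⟨P, hP, h0, h⟩ := ha
  have h1 := K.squaresTo.subst_subst hP
  rw [h, subst_mul, h] at h1
  refine mul_right_cancel₀ h0 ?_
  rw [← h1]
  ring

/-- Multipliers divide `φ ^ d`, so they form finitely many associate classes. Two in one class
differ by a constant `c`, and comparing `a(x) a(Kx) = φ ^ d` for both gives `c ^ 2 = 1`. -/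
theorem finite_multipliers (K : BirationalInvolution n) (d : ℕ) : (multipliers K d).Finite := by
  have hφ : K.phi ^ d ≠ 0 := pow_ne_zero _ K.phi_ne_zero
  have hφ' : Associates.mk (K.phi ^ d) ≠ 0 := Associates.mk_ne_zero.2 hφ
  have hfin : {b | b ∣ Associates.mk (K.phi ^ d)}.Finite :=
    @Finite.of_fintype _ (UniqueFactorizationMonoid.fintypeSubtypeDvd _ hφ')
  refine Set.Finite.of_finite_fibers Associates.mk (hfin.subset ?_) ?_
  · rintro _ ⟨a, ha, rfl⟩
    exact Associates.mk_dvd_mk.2 ⟨_, (mul_subst_of_mem_multipliers ha).symm⟩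
  · rintro _ ⟨a, ha, rfl⟩
    refine (Set.toFinite {a, -a}).subset ?_
    rintro b ⟨hb, hab⟩
    obtain ⟨u, hu⟩ := Associates.mk_eq_mk_iff_associated.1 (Eq.symm hab)
    obtain ⟨c, -, hc⟩ := isUnit_iff_eq_C_of_isReduced.1 u.isUnit
    have h1 := mul_subst_of_mem_multipliers hb
    have h2 := mul_subst_of_mem_multipliers ha
    rw [← hu, hc, subst_mul, subst_C] at h1
    have h3 : (C (c * c) : Poly n) = 1 := by
      refine mul_right_cancel₀ hφ ?_
      rw [one_mul]
      nth_rewrite 1 [← h2]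
      rw [← h1, C_mul]
      ring
    rw [← C_1, C_inj] at h3
    rcases mul_self_eq_one_iff.1 h3 with rfl | rfl
    · left; rw [← hu, hc]; simp
    · right; rw [← hu, hc]; simp

end Involution

/-! ### Cocycles, covariant pencils and invariants -/

section Cocycle

variable {n r : ℕ}

/-- The multiplier of the generator `g` obtained from a multiplier of `K`. -/
noncomputable def twist (c : Fin r → GL (Fin (n + 1)) ℂ) (α : Option (Fin r) → Poly n) :
    Option (Fin r) → Poly n
  | none => α none
  | some k => subst (linMap (c k).val) (α (some k))

/-- The forms which are covariant under all generators, with given multipliers. -/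
noncomputable def commonSystem (K : BirationalInvolution n) (m : ℕ) (c : Fin r → GL (Fin (n + 1)) ℂ)
    (α : Option (Fin r) → Poly n) : Submodule ℂ (homogeneousSubmodule (Fin (n + 1)) ℂ m) :=
  ⨅ g, covariantSystem (gen K c g) m (twist c α g)

/-- The cocycle with given values on the generators. -/
noncomputable def extendCocycle (K : BirationalInvolution n) (c : Fin r → GL (Fin (n + 1)) ℂ)
    (β : Option (Fin r) → Poly n) : List (Option (Fin r)) → Poly n
  | [] => 1
  | g :: w => subst (realize K c w) (β g) * extendCocycle K c β w

theorem realize_append (K : BirationalInvolution n) (c : Fin r → GL (Fin (n + 1)) ℂ)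
    (u v : List (Option (Fin r))) :
    realize K c (u ++ v) = comp (realize K c u) (realize K c v) := by
  induction u with
  | nil => funext i; simp [realize, comp]
  | cons g u ih => rw [List.cons_append, realize, ih, realize, comp_assoc]

theorem isCocycle_extendCocycle (K : BirationalInvolution n) (c : Fin r → GL (Fin (n + 1)) ℂ)
    (β : Option (Fin r) → Poly n) : IsCocycle K c (extendCocycle K c β) := by
  intro u v
  induction u with
  | nil => simp [extendCocycle, subst]
  | cons g u ih =>
    rw [List.cons_append, extendCocycle, ih, extendCocycle, realize_append, subst_comp, subst_mul]
    ring

theorem iInf_covariantSystem_extendCocycle (K : BirationalInvolution n) (m : ℕ)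
    (c : Fin r → GL (Fin (n + 1)) ℂ) (β : Option (Fin r) → Poly n) :
    (⨅ g, covariantSystem (gen K c g) m (β g)) ≤
      ⨅ w, covariantSystem (realize K c w) m (extendCocycle K c β w) := by
  intro P hP
  simp only [Submodule.mem_iInf, mem_covariantSystem] at hP ⊢
  intro w
  induction w with
  | nil => simp [realize, extendCocycle]
  | cons g w ih =>
    rw [realize, subst_comp, hP g, subst_mul, ih, extendCocycle]
    ring

/-- The form `P(C_k⁻¹ x)` is covariant under `K`, so each multiplier on a generator comes from the
set `multipliers K m`, which does not involve `C`. -/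
theorem exists_twist_eq (K : BirationalInvolution n) {m : ℕ} (c : Fin r → GL (Fin (n + 1)) ℂ)
    {β : Option (Fin r) → Poly n} {P : Poly n} (hP : P.IsHomogeneous m) (h0 : P ≠ 0)
    (h : ∀ g, subst (gen K c g) P = β g * P) :
    ∃ α : Option (Fin r) → Poly n, (∀ g, α g ∈ multipliers K m) ∧ twist c α = β := by
  refine ⟨fun g => g.elim (β none) fun k => subst (linMap ((c k)⁻¹).val) (β (some k)), ?_, ?_⟩
  · rintro (_ | k)
    · exact ⟨P, hP, h0, h none⟩
    · refine ⟨subst (linMap ((c k)⁻¹).val) P, isHomogeneous_subst_linMap _ hP, fun hz => h0 ?_, ?_⟩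
      · exact subst_linMap_injective (c k)⁻¹ (hz.trans (subst_zero _).symm)
      · refine (subst_conj_eq_iff K (c k) _ P).1 ?_
        change subst (conj K (c k)) P = subst _ (subst _ (β (some k))) * P
        rw [subst_linMap_inv]
        exact h (some k)
  · funext g
    rcases g with _ | k
    · rfl
    · exact subst_linMap_inv _ _

/-- This replaces the quantifier over cocycles by a finite one: values on one-letter words already
cut out a system containing the given one, and conversely values on generators extend to all words.
-/
theorem hasCovariantSystem_iff (K : BirationalInvolution n) (m : ℕ)
    (c : Fin r → GL (Fin (n + 1)) ℂ) :
    HasCovariantSystem K m c ↔ ∃ α : Option (Fin r) → multipliers K m,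
      2 ≤ Module.finrank ℂ (commonSystem K m c fun g => (α g).val) := by
  constructor
  · rintro ⟨a, -, h⟩
    have hle : (⨅ w, covariantSystem (realize K c w) m (a w)) ≤
        ⨅ g, covariantSystem (gen K c g) m (a [g]) := by
      refine le_iInf fun g => (iInf_le _ [g]).trans_eq ?_
      rw [realize, realize, comp_identity]
    obtain ⟨P, hP, _, _, hli⟩ := (two_le_finrank_iff _).1 h
    have hPg := hle hP
    simp only [Submodule.mem_iInf, mem_covariantSystem] at hPg
    obtain ⟨α, hα, hαβ⟩ := exists_twist_eq K c P.2
      (fun h0 => hli.ne_zero 0 (Subtype.ext h0)) hPg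
    refine ⟨fun g => ⟨α g, hα g⟩, h.trans (Submodule.finrank_mono ?_)⟩
    rw [commonSystem]
    simpa only [hαβ] using hle
  · rintro ⟨α, h⟩
    exact ⟨_, isCocycle_extendCocycle K c (twist c fun g => (α g).val),
      h.trans (Submodule.finrank_mono (iInf_covariantSystem_extendCocycle K m c _))⟩

/-- The ratio of two covariant forms is invariant; a common factor `X 0 ^ (m - d)` raises the degree
to `m`. -/
theorem HasCovariantSystem.hasInvariant {K : BirationalInvolution n} {d m : ℕ} (hdm : d ≤ m)
    {c : Fin r → GL (Fin (n + 1)) ℂ} (h : HasCovariantSystem K d c) : HasInvariant K m c := by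
  obtain ⟨a, -, h⟩ := h
  obtain ⟨p, hp, q, hq, hli⟩ := (two_le_finrank_iff _).1 h
  simp only [Submodule.mem_iInf, mem_covariantSystem] at hp hq
  have hx : ((X 0 : Poly n) ^ (m - d)) ≠ 0 := pow_ne_zero _ (X_ne_zero _)
  have hhom : ∀ f : homogeneousSubmodule (Fin (n + 1)) ℂ d,
      ((X 0 : Poly n) ^ (m - d) * f.1).IsHomogeneous m := by
    intro f
    have := (isHomogeneous_X_pow (R := ℂ) (0 : Fin (n + 1)) (m - d)).mul f.2
    rwa [Nat.sub_add_cancel hdm] at this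
  refine ⟨X 0 ^ (m - d) * p.1, X 0 ^ (m - d) * q.1, hhom p, hhom q, ?_, fun w => ?_⟩
  · rw [LinearIndependent.pair_iff] at hli ⊢
    intro s t hst
    refine hli s t (Subtype.ext (mul_left_cancel₀ hx ?_))
    rw [← mul_smul_comm, ← mul_smul_comm, ← mul_add] at hst
    exact hst.trans (mul_zero _).symm
  · rw [subst_mul, subst_mul, hp, hq]
    ring

theorem HasInvariant.exists_hasCovariantSystem {K : BirationalInvolution n} {m : ℕ}
    {c : Fin r → GL (Fin (n + 1)) ℂ} (h : HasInvariant K m c) :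
    ∃ d ≤ m, HasCovariantSystem K d c := by
  obtain ⟨P, Q, hP, hQ, hli, h⟩ := h
  have hP0 : P ≠ 0 := by simpa using hli.ne_zero 0
  have hQ0 : Q ≠ 0 := by simpa using hli.ne_zero 1
  obtain ⟨p, q, D, hpq, rfl, rfl⟩ := UniqueFactorizationMonoid.exists_reduced_factors P hP0 Q
  obtain ⟨e, he, hD, hp⟩ := isHomogeneous_of_mul hP hP0
  obtain ⟨e', he', hD', hq⟩ := isHomogeneous_of_mul hQ hQ0
  have hD0 := left_ne_zero_of_mul hP0
  have hp0 := right_ne_zero_of_mul hP0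
  have hq0 := right_ne_zero_of_mul hQ0
  obtain rfl := hD.inj_right hD' hD0
  have key : ∀ g, ∃ b, subst (gen K c g) p = b * p ∧ subst (gen K c g) q = b * q := by
    intro g
    obtain ⟨φ, hφ⟩ := exists_squaresTo_gen K c g
    have hDg := hφ.subst_ne_zero hD hD0
    have h1 := h [g]
    -- Invariance of `D p / D q` becomes invariance of `p / q` after cancelling `D(gx)` and `D(x)`,
    -- both nonzero.
    rw [realize, realize, comp_identity, subst_mul, subst_mul] at h1
    have h2 : subst (gen K c g) p * q = subst (gen K c g) q * p := by
      refine mul_left_cancel₀ (mul_ne_zero hDg hD0) ?_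
      linear_combination h1
    -- Since `p` divides `p(gx) q(x)` and is coprime to `q`, it divides `p(gx)`.
    obtain ⟨b, hb⟩ : p ∣ subst (gen K c g) p := hpq.dvd_of_dvd_mul_right ⟨_, h2.trans (mul_comm _ _)⟩
    refine ⟨b, hb.trans (mul_comm _ _), mul_left_cancel₀ hp0 ?_⟩
    rw [mul_comm p, ← h2, hb]
    ring
  choose β hβp hβq using key
  refine ⟨m - e, Nat.sub_le _ _, _, isCocycle_extendCocycle K c β, ?_⟩
  refine le_trans ?_ (Submodule.finrank_mono (iInf_covariantSystem_extendCocycle K _ c β))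
  have hmp : (⟨p, hp⟩ : homogeneousSubmodule (Fin (n + 1)) ℂ (m - e)) ∈
      ⨅ g, covariantSystem (gen K c g) (m - e) (β g) := by
    simpa only [Submodule.mem_iInf, mem_covariantSystem] using hβp
  have hmq : (⟨q, hq⟩ : homogeneousSubmodule (Fin (n + 1)) ℂ (m - e)) ∈
      ⨅ g, covariantSystem (gen K c g) (m - e) (β g) := by
    simpa only [Submodule.mem_iInf, mem_covariantSystem] using hβq
  refine (two_le_finrank_iff _).2 ⟨_, hmp, _, hmq, ?_⟩
  rw [LinearIndependent.pair_iff] at hli ⊢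
  intro s t hst
  refine hli s t ?_
  have : s • p + t • q = 0 := congrArg Subtype.val hst
  rw [← mul_smul_comm, ← mul_smul_comm, ← mul_add, this, mul_zero]

theorem hasInvariant_iff (K : BirationalInvolution n) (m : ℕ) (c : Fin r → GL (Fin (n + 1)) ℂ) :
    HasInvariant K m c ↔ ∃ d : Fin (m + 1), HasCovariantSystem K d c :=
  ⟨fun h => let ⟨d, hd, h'⟩ := h.exists_hasCovariantSystem; ⟨⟨d, Nat.lt_succ_of_le hd⟩, h'⟩,
    fun ⟨d, h⟩ => h.hasInvariant (Nat.le_of_lt_succ d.2)⟩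

end Cocycle

/-! ### Covariance equations with a generic matrix -/

section Deviation

variable {n : ℕ} {R S : Type*} [CommRing R] [Algebra ℂ R] [CommRing S] [Algebra ℂ S]

/-- The linear map `P ↦ P(Mx)`, where the matrix `M` has entries in a `ℂ`-algebra. -/
noncomputable def substMatrix (M : Matrix (Fin (n + 1)) (Fin (n + 1)) R) :
    Poly n →ₗ[ℂ] MvPolynomial (Fin (n + 1)) R :=
  (aeval fun i => ∑ j, C (M i j) * X j).toLinearMap

/-- The linear map `P ↦ P(M K(x)) - a(x) P(Mx)`. -/
noncomputable def deviation (K : PolyMap n) (a : Poly n)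
    (M : Matrix (Fin (n + 1)) (Fin (n + 1)) R) : Poly n →ₗ[ℂ] MvPolynomial (Fin (n + 1)) R :=
  (aeval fun i => ∑ j, C (M i j) * map (algebraMap ℂ R) (K j)).toLinearMap -
    LinearMap.mulLeft ℂ (map (algebraMap ℂ R) a) ∘ₗ substMatrix M

theorem substMatrix_eq_subst (M : Matrix (Fin (n + 1)) (Fin (n + 1)) ℂ) (P : Poly n) :
    substMatrix M P = subst (linMap M) P := rfl

theorem deviation_eq (K : PolyMap n) (a : Poly n) (M : Matrix (Fin (n + 1)) (Fin (n + 1)) ℂ)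
    (P : Poly n) :
    deviation K a M P = subst K (subst (linMap M) P) - a * subst (linMap M) P := by
  rw [← subst_comp]
  have : comp (linMap M) K = fun i => ∑ j, C (M i j) * K j := funext (comp_linMap_apply M K)
  rw [this]
  simp only [deviation, LinearMap.sub_apply, LinearMap.comp_apply, LinearMap.mulLeft_apply,
    substMatrix_eq_subst, Algebra.algebraMap_self, map_id]
  rfl

theorem mapAlgHom_substMatrix (f : R →ₐ[ℂ] S) (M : Matrix (Fin (n + 1)) (Fin (n + 1)) R)
    (P : Poly n) : mapAlgHom f (substMatrix M P) = substMatrix (M.map f) P := by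
  rw [substMatrix, AlgHom.toLinearMap_apply, comp_aeval_apply]
  simp [substMatrix, mapAlgHom_apply]

theorem mapAlgHom_map_algebraMap (f : R →ₐ[ℂ] S) (P : Poly n) :
    mapAlgHom f (map (algebraMap ℂ R) P) = map (algebraMap ℂ S) P := by
  have : (f : R →+* S).comp (algebraMap ℂ R) = algebraMap ℂ S := f.comp_algebraMap
  rw [mapAlgHom_apply]
  change map (f : R →+* S) _ = _
  rw [map_map, this]

/-- Specialising the parameters commutes with forming the equations, so minors of the generic system
evaluate to minors of the system at `C`. -/
theorem mapAlgHom_deviation (f : R →ₐ[ℂ] S) (K : PolyMap n) (a : Poly n)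
    (M : Matrix (Fin (n + 1)) (Fin (n + 1)) R) (P : Poly n) :
    mapAlgHom f (deviation K a M P) = deviation K a (M.map f) P := by
  simp only [deviation, LinearMap.sub_apply, LinearMap.comp_apply, LinearMap.mulLeft_apply,
    AlgHom.toLinearMap_apply, map_sub, map_mul, mapAlgHom_map_algebraMap, mapAlgHom_substMatrix]
  rw [comp_aeval_apply]
  simp only [map_sum, map_mul, mapAlgHom_map_algebraMap]
  simp [mapAlgHom_apply]

variable {τ M₀ : Type*} [AddCommMonoid M₀] {w : τ → M₀} {d : M₀}

theorem hasHomogeneousCoeffs_substMatrix {M : Matrix (Fin (n + 1)) (Fin (n + 1)) (MvPolynomial τ ℂ)}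
    (hM : ∀ i j, (M i j).IsWeightedHomogeneous w d) {P : Poly n} {m : ℕ} (hP : P.IsHomogeneous m) :
    HasHomogeneousCoeffs w (m • d) (substMatrix M P) := by
  refine HasHomogeneousCoeffs.aeval hP fun i => HasHomogeneousCoeffs.sum fun j => ?_
  simpa using (hasHomogeneousCoeffs_C (hM i j)).mul (hasHomogeneousCoeffs_X j)

theorem hasHomogeneousCoeffs_deviation (K : PolyMap n) (a : Poly n)
    {M : Matrix (Fin (n + 1)) (Fin (n + 1)) (MvPolynomial τ ℂ)}
    (hM : ∀ i j, (M i j).IsWeightedHomogeneous w d) {P : Poly n} {m : ℕ} (hP : P.IsHomogeneous m) :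
    HasHomogeneousCoeffs w (m • d) (deviation K a M P) := by
  refine HasHomogeneousCoeffs.sub ?_ ?_
  · refine HasHomogeneousCoeffs.aeval hP fun i => HasHomogeneousCoeffs.sum fun j => ?_
    have := (hasHomogeneousCoeffs_C (hM i j)).mul (hasHomogeneousCoeffs_map (w := w) (K j))
    rwa [add_zero] at this
  · have := (hasHomogeneousCoeffs_map (w := w) a).mul (hasHomogeneousCoeffs_substMatrix hM hP)
    rwa [zero_add] at this

theorem subst_linMap_smul (c : ℂ) (M : Matrix (Fin (n + 1)) (Fin (n + 1)) ℂ) {P : Poly n} {m : ℕ}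
    (hP : P.IsHomogeneous m) : subst (linMap (c • M)) P = C (c ^ m) * subst (linMap M) P := by
  rw [C_pow, ← subst_smul_map hP]
  congr 1
  funext i
  simp [linMap, Finset.mul_sum, mul_assoc]

/-- Both terms scale by `c ^ m`. This allows the inverse matrix to be replaced by the adjugate. -/
theorem deviation_smul_eq_zero_iff (K : PolyMap n) (a : Poly n) {c : ℂ} (hc : c ≠ 0)
    (M : Matrix (Fin (n + 1)) (Fin (n + 1)) ℂ) {P : Poly n} {m : ℕ} (hP : P.IsHomogeneous m) :
    deviation K a (c • M) P = 0 ↔ deviation K a M P = 0 := by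
  rw [deviation_eq, deviation_eq, subst_linMap_smul c M hP, subst_mul, subst_C]
  have : C (c ^ m) * subst K (subst (linMap M) P) - a * (C (c ^ m) * subst (linMap M) P) =
      C (c ^ m) * (subst K (subst (linMap M) P) - a * subst (linMap M) P) := by ring
  rw [this, mul_eq_zero, or_iff_right]
  rw [C_eq_zero]
  exact pow_ne_zero _ hc

end Deviation

/-! ### Multihomogeneous conditions and quasi-projectivity -/

section AlgebraicConditions

variable {n r : ℕ}

/-- The coordinates of a tuple of matrices. -/
def coords (c : Fin r → GL (Fin (n + 1)) ℂ) : Fin r × Fin (n + 1) × Fin (n + 1) → ℂ :=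
  fun x => (c x.1).val x.2.1 x.2.2

/-- A condition on tuples of invertible matrices given by multihomogeneous equations. -/
def IsAlgebraicCondition (R : (Fin r → GL (Fin (n + 1)) ℂ) → Prop) : Prop :=
  ∃ S : Set (EntryPoly n r), (∀ f ∈ S, IsMultihomogeneous f) ∧
    ∀ c, R c ↔ ∀ f ∈ S, eval (coords c) f = 0

theorem IsAlgebraicCondition.congr {R R' : (Fin r → GL (Fin (n + 1)) ℂ) → Prop}
    (h : IsAlgebraicCondition R) (hR : ∀ c, R' c ↔ R c) : IsAlgebraicCondition R' := by
  obtain ⟨S, hS, h⟩ := h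
  exact ⟨S, hS, fun c => (hR c).trans (h c)⟩

theorem isMultihomogeneous_prod {ι : Type*} [Fintype ι] {f : ι → EntryPoly n r}
    (h : ∀ i, IsMultihomogeneous (f i)) : IsMultihomogeneous (∏ i, f i) := by
  choose d hd using h
  exact ⟨∑ i, d i, IsWeightedHomogeneous.prod _ _ _ fun i _ => hd i⟩

/-- A finite union of zero loci is cut out by the products with one equation from each. For empty
`ι` the only product is 1, whose zero locus is empty. -/
theorem IsAlgebraicCondition.exists {ι : Type*} [Finite ι]
    {R : ι → (Fin r → GL (Fin (n + 1)) ℂ) → Prop} (h : ∀ i, IsAlgebraicCondition (R i)) :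
    IsAlgebraicCondition fun c => ∃ i, R i c := by
  have := Fintype.ofFinite ι
  choose S hS h using h
  refine ⟨{f | ∃ g : ι → EntryPoly n r, (∀ i, g i ∈ S i) ∧ f = ∏ i, g i}, ?_, fun c => ?_⟩
  · rintro _ ⟨g, hg, rfl⟩
    exact isMultihomogeneous_prod fun i => hS i _ (hg i)
  · constructor
    · rintro ⟨i, hi⟩ _ ⟨g, hg, rfl⟩
      rw [map_prod]
      exact Finset.prod_eq_zero (Finset.mem_univ i) ((h i c).1 hi _ (hg i))
    · intro hall
      by_contra! hcon
      have hex : ∀ i, ∃ f ∈ S i, eval (coords c) f ≠ 0 := by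
        intro i
        have := (h i c).not.1 (hcon i)
        push Not at this
        exact this
      choose g hg hg0 using hex
      have h0 := hall _ ⟨g, hg, rfl⟩
      rw [map_prod] at h0
      exact Finset.prod_ne_zero_iff.2 (fun i _ => hg0 i) h0

theorem eval_mul_of_isWeightedHomogeneous {f : EntryPoly n r} {d : Fin r → ℕ}
    (hf : f.IsWeightedHomogeneous
      (fun x : Fin r × Fin (n + 1) × Fin (n + 1) => (Pi.single x.1 1 : Fin r → ℕ)) d)
    (u : Fin r → ℂ) (y : Fin r × Fin (n + 1) × Fin (n + 1) → ℂ) :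
    eval (fun x => u x.1 * y x) f = (∏ k, u k ^ d k) * eval y f := by
  rw [eval_eq', eval_eq', Finset.mul_sum]
  refine Finset.sum_congr rfl fun s hs => ?_
  have hd : ∀ k, d k = ∑ x, s x * (Pi.single x.1 1 : Fin r → ℕ) k := by
    intro k
    rw [← hf (mem_support_iff.1 hs), Finsupp.weight_apply, Finsupp.sum_fintype, Finset.sum_apply]
    · rfl
    · exact fun _ => zero_smul _ _
  have hprod : ∏ k, u k ^ d k = ∏ x, u x.1 ^ s x := by
    simp_rw [hd, ← Finset.prod_pow_eq_pow_sum]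
    rw [Finset.prod_comm]
    refine Finset.prod_congr rfl fun x _ => ?_
    rw [Finset.prod_eq_single x.1]
    · simp
    · intro k _ hk
      simp [hk]
    · simp
  rw [hprod]
  simp_rw [mul_pow, Finset.prod_mul_distrib]
  ring

/-- The chosen representative of each factor differs from `c k` by its own scalar; multihomogeneity
pulls out the powers of these scalars. -/
theorem eval_rep_toPoint_eq_zero_iff {f : EntryPoly n r} (hf : IsMultihomogeneous f)
    (c : Fin r → GL (Fin (n + 1)) ℂ) :
    eval (fun x => (toPoint c x.1).rep x.2.1 x.2.2) f = 0 ↔ eval (coords c) f = 0 := by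
  obtain ⟨d, hd⟩ := hf
  choose u hu using fun k => Projectivization.exists_smul_eq_mk_rep ℂ (c k).val (c k).ne_zero
  have h : (fun x : Fin r × Fin (n + 1) × Fin (n + 1) => (toPoint c x.1).rep x.2.1 x.2.2) =
      fun x => (u x.1).val * coords c x := by
    funext x
    rw [toPoint, ← hu]
    rfl
  rw [h, eval_mul_of_isWeightedHomogeneous hd (fun k => (u k).val), mul_eq_zero, or_iff_right]
  exact Finset.prod_ne_zero_iff.2 fun k _ => pow_ne_zero _ (u k).ne_zero

/-- The generic `k`-th matrix. -/
noncomputable def genericMatrix (n : ℕ) {r : ℕ} (k : Fin r) :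
    Matrix (Fin (n + 1)) (Fin (n + 1)) (EntryPoly n r) :=
  Matrix.of fun i j => X (k, i, j)

theorem isWeightedHomogeneous_genericMatrix (k : Fin r) (i j : Fin (n + 1)) :
    (genericMatrix n k i j).IsWeightedHomogeneous
      (fun x : Fin r × Fin (n + 1) × Fin (n + 1) => (Pi.single x.1 1 : Fin r → ℕ))
      (Pi.single k 1) :=
  isWeightedHomogeneous_X _ _ _

theorem isMultihomogeneous_det_genericMatrix (k : Fin r) :
    IsMultihomogeneous (genericMatrix n k).det :=
  ⟨_, isWeightedHomogeneous_det fun i j => isWeightedHomogeneous_genericMatrix k i j⟩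

theorem eval_det_genericMatrix (y : Fin r × Fin (n + 1) × Fin (n + 1) → ℂ) (k : Fin r) :
    eval y (genericMatrix n k).det = (Matrix.of fun i j => y (k, i, j)).det := by
  rw [RingHom.map_det]
  congr 1
  ext i j
  simp [genericMatrix]

/-- A multihomogeneous algebraic condition cuts out a closed subset of `PGL(n+1, ℂ)^r`. -/
theorem IsAlgebraicCondition.isQuasiProjective {R : (Fin r → GL (Fin (n + 1)) ℂ) → Prop}
    (h : IsAlgebraicCondition R) :
    IsQuasiProjective {p : MatrixSpace n r | ∃ c, p = toPoint c ∧ R c} := by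
  obtain ⟨S, hS, h⟩ := h
  -- The subtracted locus is where some matrix is singular, that is, the complement of `PGL(n+1,
  -- ℂ)^r`.
  refine ⟨S, {∏ k, (genericMatrix n k).det}, hS, ?_, ?_⟩
  · rintro _ rfl
    exact isMultihomogeneous_prod isMultihomogeneous_det_genericMatrix
  · ext p
    have hdet : p ∉ zeroLocus {∏ k, (genericMatrix n k).det} ↔ ∀ k, (p k).rep.det ≠ 0 := by
      simp only [zeroLocus, Set.mem_ofPred_eq, Set.mem_singleton_iff, forall_eq, map_prod,
        eval_det_genericMatrix, Finset.prod_eq_zero_iff, Finset.mem_univ, true_and, not_exists]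
      rfl
    rw [Set.mem_sdiff, hdet]
    constructor
    · rintro ⟨c, rfl, hc⟩
      refine ⟨fun f hf => (eval_rep_toPoint_eq_zero_iff (hS f hf) c).2 ((h c).1 hc f hf),
        fun k => ?_⟩
      obtain ⟨u, hu⟩ := Projectivization.exists_smul_eq_mk_rep ℂ (c k).val (c k).ne_zero
      rw [toPoint, ← hu, Units.smul_def, Matrix.det_smul]
      exact mul_ne_zero (pow_ne_zero _ u.ne_zero) (Matrix.GeneralLinearGroup.det_ne_zero (c k))
    · rintro ⟨hp, hne⟩
      have heq : p = toPoint fun k => Matrix.GeneralLinearGroup.mkOfDetNeZero _ (hne k) := by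
        funext k
        exact (Projectivization.mk_rep (p k)).symm
      refine ⟨_, heq, (h _).2 fun f hf => ?_⟩
      exact hp f hf

/-- The matrix of forms in the parameters which represents, up to a factor, the inverse of the
collineation used to build a generator. -/
noncomputable def inverseMatrix (n r : ℕ) :
    Option (Fin r) → Matrix (Fin (n + 1)) (Fin (n + 1)) (EntryPoly n r)
  | none => 1
  | some k => (genericMatrix n k).adjugate

theorem exists_isWeightedHomogeneous_inverseMatrix (g : Option (Fin r)) :
    ∃ d : Fin r → ℕ, ∀ i j, (inverseMatrix n r g i j).IsWeightedHomogeneous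
      (fun x : Fin r × Fin (n + 1) × Fin (n + 1) => (Pi.single x.1 1 : Fin r → ℕ)) d := by
  rcases g with _ | k
  · refine ⟨0, fun i j => ?_⟩
    rw [inverseMatrix, Matrix.one_apply]
    split_ifs
    · exact isWeightedHomogeneous_one _ _
    · exact isWeightedHomogeneous_zero _ _ _
  · exact ⟨_, isWeightedHomogeneous_adjugate (isWeightedHomogeneous_genericMatrix k)⟩

theorem mem_covariantSystem_gen_iff (K : BirationalInvolution n) {m : ℕ}
    (c : Fin r → GL (Fin (n + 1)) ℂ) (α : Option (Fin r) → Poly n) (g : Option (Fin r))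
    (P : homogeneousSubmodule (Fin (n + 1)) ℂ m) :
    P ∈ covariantSystem (gen K c g) m (twist c α g) ↔
      deviation K.map (α g) ((inverseMatrix n r g).map (aeval (coords c))) P.1 = 0 := by
  rw [mem_covariantSystem]
  rcases g with _ | k
  · have h1 : (inverseMatrix n r none).map (aeval (R := ℂ) (coords c)) = 1 := by
      rw [inverseMatrix, Matrix.map_one _ (map_zero _) (map_one _)]
    rw [h1, deviation_eq, linMap_one, subst_identity, sub_eq_zero]
    rfl
  · have h1 : (inverseMatrix n r (some k)).map (aeval (R := ℂ) (coords c)) =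
        (c k).val.det • (c k)⁻¹.val := by
      have h2 : (genericMatrix n k).map (aeval (R := ℂ) (coords c)) = (c k).val := by
        ext i j
        simp [genericMatrix, coords]
      have h3 := AlgHom.map_adjugate (aeval (R := ℂ) (coords c)) (genericMatrix n k)
      rw [AlgHom.mapMatrix_apply, AlgHom.mapMatrix_apply, h2] at h3
      rw [inverseMatrix, h3, Matrix.coe_units_inv, Matrix.inv_def, smul_smul,
        Ring.mul_inverse_cancel _ ((Matrix.isUnit_iff_isUnit_det _).1 (c k).isUnit), one_smul]
    rw [h1, deviation_smul_eq_zero_iff _ _ (Matrix.GeneralLinearGroup.det_ne_zero (c k)) _ P.2,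
      deviation_eq, sub_eq_zero]
    exact subst_conj_eq_iff K (c k) _ _

/-- The equations of the common system, as a linear map to coefficients. -/
noncomputable def deviationCoeffs (K : BirationalInvolution n) (m : ℕ)
    (c : Fin r → GL (Fin (n + 1)) ℂ) (α : Option (Fin r) → Poly n) :
    homogeneousSubmodule (Fin (n + 1)) ℂ m →ₗ[ℂ]
      (Option (Fin r) × (Fin (n + 1) →₀ ℕ) → ℂ) :=
  LinearMap.pi fun x => lcoeff ℂ x.2 ∘ₗ
    deviation K.map (α x.1) ((inverseMatrix n r x.1).map (aeval (coords c))) ∘ₗ Submodule.subtype _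

theorem ker_deviationCoeffs (K : BirationalInvolution n) (m : ℕ)
    (c : Fin r → GL (Fin (n + 1)) ℂ) (α : Option (Fin r) → Poly n) :
    LinearMap.ker (deviationCoeffs K m c α) = commonSystem K m c α := by
  ext P
  rw [commonSystem, Submodule.mem_iInf, LinearMap.mem_ker]
  simp_rw [mem_covariantSystem_gen_iff]
  constructor
  · intro h g
    ext s
    exact congrFun h (g, s)
  · intro h
    funext x
    exact (congrArg (coeff x.2) (h x.1)).trans (coeff_zero _)

theorem isAlgebraicCondition_two_le_finrank_commonSystem (K : BirationalInvolution n) (m : ℕ)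
    (α : Option (Fin r) → Poly n) :
    IsAlgebraicCondition fun c : Fin r → GL (Fin (n + 1)) ℂ =>
      2 ≤ Module.finrank ℂ (commonSystem K m c α) := by
  set N := Module.finrank ℂ (homogeneousSubmodule (Fin (n + 1)) ℂ m)
  let e : Module.Basis (Fin N) ℂ (homogeneousSubmodule (Fin (n + 1)) ℂ m) := Module.finBasis ℂ _
  let A : (Fin (N - 1) → Fin N) → (Fin (N - 1) → Option (Fin r) × (Fin (n + 1) →₀ ℕ)) →
      Matrix (Fin (N - 1)) (Fin (N - 1)) (EntryPoly n r) := fun γ ρ => Matrix.of fun i j =>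
    coeff (ρ j).2 (deviation K.map (α (ρ j).1) (inverseMatrix n r (ρ j).1) (e (γ i)).1)
  refine ⟨{f | ∃ γ ρ, f = (A γ ρ).det}, ?_, fun c => ?_⟩
  · rintro _ ⟨γ, ρ, rfl⟩
    choose d hd using exists_isWeightedHomogeneous_inverseMatrix (n := n) (r := r)
    -- Column `j` of the minor uses only the generator `(ρ j).1`, so its multidegree is the same in
    -- every row.
    exact ⟨_, isWeightedHomogeneous_det (δ := fun j => m • d (ρ j).1) fun i j =>
      hasHomogeneousCoeffs_deviation K.map _ (hd _) (e (γ i)).2 _⟩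
  · have heval : ∀ γ ρ, eval (coords c) (A γ ρ).det =
        (Matrix.of fun i j => deviationCoeffs K m c α (e (γ i)) (ρ j)).det := by
      intro γ ρ
      rw [RingHom.map_det]
      congr 1
      ext i j
      have := congrArg (coeff (ρ j).2) (mapAlgHom_deviation (aeval (R := ℂ) (coords c)) K.map
        (α (ρ j).1) (inverseMatrix n r (ρ j).1) (e (γ i)).1)
      rw [mapAlgHom_apply, coeff_map] at this
      exact this
    change 2 ≤ Module.finrank ℂ (commonSystem K m c α) ↔ _
    rw [← ker_deviationCoeffs, two_le_finrank_ker_iff e]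
    constructor
    · rintro h _ ⟨γ, ρ, rfl⟩
      rw [heval]
      exact h γ ρ
    · intro h γ ρ
      rw [← heval]
      exact h _ ⟨γ, ρ, rfl⟩

theorem isAlgebraicCondition_hasCovariantSystem (K : BirationalInvolution n) (m r : ℕ) :
    IsAlgebraicCondition fun c : Fin r → GL (Fin (n + 1)) ℂ => HasCovariantSystem K m c := by
  have := (finite_multipliers K m).to_subtype
  exact (IsAlgebraicCondition.exists fun α : Option (Fin r) → multipliers K m =>
    isAlgebraicCondition_two_le_finrank_commonSystem K m fun g => (α g).val).congr
      (hasCovariantSystem_iff K m)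

theorem isAlgebraicCondition_hasInvariant (K : BirationalInvolution n) (m r : ℕ) :
    IsAlgebraicCondition fun c : Fin r → GL (Fin (n + 1)) ℂ => HasInvariant K m c :=
  (IsAlgebraicCondition.exists fun d : Fin (m + 1) =>
    isAlgebraicCondition_hasCovariantSystem K d r).congr (hasInvariant_iff K m)

end AlgebraicConditions

/-! ### The explicit rank condition for two involutions -/

section RankCondition

variable {n m : ℕ}

/-- The action of a collineation on forms of degree `m`. -/
noncomputable def substForm (m : ℕ) (c : GL (Fin (n + 1)) ℂ) :
    homogeneousSubmodule (Fin (n + 1)) ℂ m →ₗ[ℂ] homogeneousSubmodule (Fin (n + 1)) ℂ m :=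
  (substMatrix c.val).restrict fun _ hP => isHomogeneous_subst_linMap c.val hP

theorem substForm_val (c : GL (Fin (n + 1)) ℂ) (P : homogeneousSubmodule (Fin (n + 1)) ℂ m) :
    (substForm m c P).val = subst (linMap c.val) P.val := rfl

theorem ker_substForm (c : GL (Fin (n + 1)) ℂ) : LinearMap.ker (substForm m c) = ⊥ :=
  LinearMap.ker_eq_bot.2 fun _ _ h =>
    Subtype.ext (subst_linMap_injective c (congrArg Subtype.val h))

theorem map_substForm_covariantSystem (K : BirationalInvolution n) (b : Poly n)
    (c : GL (Fin (n + 1)) ℂ) :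
    (covariantSystem K.map m b).map (substForm m c) =
      covariantSystem (conj K c) m (subst (linMap c.val) b) := by
  ext P
  rw [Submodule.mem_map, mem_covariantSystem, subst_conj_eq_iff]
  constructor
  · rintro ⟨Q, hQ, rfl⟩
    rw [substForm_val, subst_inv_linMap]
    exact hQ
  · intro h
    exact ⟨substForm m c⁻¹ P, h, Subtype.ext (subst_linMap_inv c P.val)⟩

/-- The generic matrix. -/
noncomputable def entryMatrix (n : ℕ) :
    Matrix (Fin (n + 1)) (Fin (n + 1)) (MvPolynomial (Fin (n + 1) × Fin (n + 1)) ℂ) :=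
  Matrix.of fun i j => X (i, j)

/-- The value of a linear functional on `P(Cx)`, as a polynomial in the entries of `C`. -/
noncomputable def functionalPoly (φ : Poly n →ₗ[ℂ] ℂ) (P : Poly n) :
    MvPolynomial (Fin (n + 1) × Fin (n + 1)) ℂ :=
  ∑ s ∈ (substMatrix (entryMatrix n) P).support,
    C (φ (monomial s 1)) * coeff s (substMatrix (entryMatrix n) P)

theorem isHomogeneous_functionalPoly (φ : Poly n →ₗ[ℂ] ℂ) {P : Poly n} (hP : P.IsHomogeneous m) :
    (functionalPoly φ P).IsHomogeneous m := by
  refine IsHomogeneous.sum _ _ _ fun s _ => IsHomogeneous.C_mul ?_ _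
  have := hasHomogeneousCoeffs_substMatrix (M := entryMatrix n)
    (w := (1 : Fin (n + 1) × Fin (n + 1) → ℕ)) (d := 1)
    (fun i j => isHomogeneous_X ℂ (i, j)) hP s
  rwa [smul_eq_mul, mul_one] at this

/-- The functional is applied to the monomials in `x` while the parameters stay in the coefficients;
linearity gives agreement after specialisation. -/
theorem eval_sum_functional {σ τ : Type*} (φ : MvPolynomial σ ℂ →ₗ[ℂ] ℂ)
    (F : MvPolynomial σ (MvPolynomial τ ℂ)) (y : τ → ℂ) :
    eval y (∑ s ∈ F.support, C (φ (monomial s 1)) * coeff s F) =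
      φ (mapAlgHom (aeval (R := ℂ) y) F) := by
  have h : mapAlgHom (aeval (R := ℂ) y) F =
      ∑ s ∈ F.support, eval y (coeff s F) • monomial s (1 : ℂ) := by
    conv_lhs => rw [← support_sum_monomial_coeff F]
    rw [map_sum]
    refine Finset.sum_congr rfl fun s _ => ?_
    rw [mapAlgHom_apply, map_monomial, smul_monomial, smul_eq_mul, mul_one]
    rfl
  rw [h, map_sum, map_sum]
  refine Finset.sum_congr rfl fun s _ => ?_
  rw [map_mul, eval_C, map_smul, smul_eq_mul, mul_comm]

theorem eval_functionalPoly (φ : Poly n →ₗ[ℂ] ℂ) (P : Poly n)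
    (M : Matrix (Fin (n + 1)) (Fin (n + 1)) ℂ) :
    eval (fun x => M x.1 x.2) (functionalPoly φ P) = φ (subst (linMap M) P) := by
  have hM : (entryMatrix n).map
      (aeval (R := ℂ) fun x : Fin (n + 1) × Fin (n + 1) => M x.1 x.2) = M := by
    ext i j
    simp [entryMatrix]
  rw [functionalPoly, eval_sum_functional, mapAlgHom_substMatrix, hM, substMatrix_eq_subst]

theorem exists_linearIndependent_span_eq {𝕜 V : Type*} [Field 𝕜] [AddCommGroup V] [Module 𝕜 V]
    [Module.Finite 𝕜 V] (W : Submodule 𝕜 V) :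
    ∃ (t : ℕ) (q : Fin t → V), LinearIndependent 𝕜 q ∧ Submodule.span 𝕜 (Set.range q) = W := by
  refine ⟨_, W.subtype ∘ Module.finBasis 𝕜 W,
    (Module.finBasis 𝕜 W).linearIndependent.map' _ W.ker_subtype, ?_⟩
  rw [Set.range_comp, ← Submodule.map_span, (Module.finBasis 𝕜 W).span_eq,
    Submodule.map_subtype_top]

/-- Coordinates on a subspace extend to linear functionals on the whole space. -/
theorem exists_functionals_extending_coord {𝕜 V κ : Type*} [Field 𝕜] [AddCommGroup V] [Module 𝕜 V]
    [Fintype κ] {W : Submodule 𝕜 V} (e : Module.Basis κ 𝕜 W) :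
    ∃ φ : κ → V →ₗ[𝕜] 𝕜, ∀ x : W, ∑ j, φ j x • e j = x := by
  choose φ hφ using fun j => LinearMap.exists_extend (e.coord j)
  refine ⟨φ, fun x => ?_⟩
  conv_rhs => rw [← e.sum_repr x]
  refine Finset.sum_congr rfl fun j _ => ?_
  congr 1
  exact LinearMap.congr_fun (hφ j) x

/-- A basis of the whole space which extends a basis of a given subspace. -/
theorem exists_basis_extending {𝕜 V : Type*} [Field 𝕜] [AddCommGroup V] [Module 𝕜 V]
    [Module.Finite 𝕜 V] (W : Submodule 𝕜 V) :
    ∃ (l : ℕ) (e : Module.Basis (Fin (Module.finrank 𝕜 W) ⊕ Fin l) 𝕜 V),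
      Submodule.span 𝕜 (Set.range fun i => e (Sum.inl i)) = W := by
  obtain ⟨W', h⟩ := W.exists_isCompl
  refine ⟨_, ((Module.finBasis 𝕜 W).prod (Module.finBasis 𝕜 W')).map
    (Submodule.prodEquivOfIsCompl W W' h), ?_⟩
  have : (fun i => (((Module.finBasis 𝕜 W).prod (Module.finBasis 𝕜 W')).map
      (Submodule.prodEquivOfIsCompl W W' h)) (Sum.inl i)) = W.subtype ∘ Module.finBasis 𝕜 W := by
    funext i
    simp
  rw [this, Set.range_comp, ← Submodule.map_span, (Module.finBasis 𝕜 W).span_eq,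
    Submodule.map_subtype_top]

/-- The dimension of an intersection in terms of the rank of the matrix of coordinates of bases
of the two subspaces, the first of which is part of the ambient basis. -/
theorem finrank_inf_add_rank {𝕜 V : Type*} [Field 𝕜] [AddCommGroup V] [Module 𝕜 V]
    {k l t : ℕ} (e : Module.Basis (Fin k ⊕ Fin l) 𝕜 V) (A : Matrix (Fin t) (Fin k ⊕ Fin l) 𝕜)
    (hA : LinearIndependent 𝕜 fun i => ∑ j, A i j • e j) :
    Module.finrank 𝕜 (Submodule.span 𝕜 (Set.range fun i => e (Sum.inl i)) ⊓
      Submodule.span 𝕜 (Set.range fun i => ∑ j, A i j • e j) : Submodule 𝕜 V) +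
      (Matrix.fromRows (Matrix.fromCols (1 : Matrix (Fin k) (Fin k) 𝕜)
        (0 : Matrix (Fin k) (Fin l) 𝕜)) A).rank = k + t := by
  have : Module.Finite 𝕜 V := Module.Finite.of_basis e
  set W₁ := Submodule.span 𝕜 (Set.range fun i => e (Sum.inl i)) with hW₁
  set W₂ := Submodule.span 𝕜 (Set.range fun i => ∑ j, A i j • e j) with hW₂
  set B := Matrix.fromRows (Matrix.fromCols (1 : Matrix (Fin k) (Fin k) 𝕜)
        (0 : Matrix (Fin k) (Fin l) 𝕜)) A with hB
  have h1 : Module.finrank 𝕜 W₁ = k := by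
    have := finrank_span_eq_card (e.linearIndependent.comp _ Sum.inl_injective)
    rwa [Fintype.card_fin] at this
  have h2 : Module.finrank 𝕜 W₂ = t := by
    rw [hW₂, finrank_span_eq_card hA, Fintype.card_fin]
  have hrows : (fun i => e.equivFun.symm (B.row i)) =
      Sum.elim (fun i => e (Sum.inl i)) fun i => ∑ j, A i j • e j := by
    funext i
    rw [Module.Basis.equivFun_symm_apply]
    rcases i with i | i
    · have hr : B.row (Sum.inl i) = Pi.single (Sum.inl i) 1 := by
        funext j
        rcases j with j | j
        · simp [hB, Matrix.row, Matrix.one_apply, Pi.single_apply, eq_comm]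
        · simp [hB, Matrix.row]
      rw [hr]
      simp [Pi.single_apply]
    · rfl
  -- In the basis `e` the rows of `B` are the generators of `W₁` and `W₂`, so the row space is a
  -- copy of `W₁ ⊔ W₂`.
  have h3 : B.rank = Module.finrank 𝕜 (W₁ ⊔ W₂ : Submodule 𝕜 V) := by
    rw [Matrix.rank_eq_finrank_span_row, ← e.equivFun.symm.finrank_map_eq, Submodule.map_span,
      ← Set.range_comp, hW₁, hW₂, ← Submodule.span_union, ← Set.Sum.elim_range, ← hrows]
    rfl
  rw [h3, add_comm, Submodule.finrank_sup_add_finrank_inf_eq, h1, h2]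

end RankCondition

end Collineated

theorem mainTheorem4 (n : ℕ) (K : Collineated.BirationalInvolution n) (m : ℕ) :
    (∀ r : ℕ,
      Collineated.IsQuasiProjective
        {p : Collineated.MatrixSpace n r | ∃ C : Fin r → GL (Fin (n + 1)) ℂ,
          p = Collineated.toPoint C ∧ Collineated.HasInvariant K m C} ∧
      Collineated.IsQuasiProjective
        {p : Collineated.MatrixSpace n r | ∃ C : Fin r → GL (Fin (n + 1)) ℂ,
          p = Collineated.toPoint C ∧ Collineated.HasCovariantSystem K m C}) ∧
    ∀ a b : Collineated.Poly n, ∃ (k l t : ℕ)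
      (e : Module.Basis (Fin k ⊕ Fin l) ℂ
        (MvPolynomial.homogeneousSubmodule (Fin (n + 1)) ℂ m))
      (E : Matrix (Fin t) (Fin k ⊕ Fin l) (MvPolynomial (Fin (n + 1) × Fin (n + 1)) ℂ)),
      Submodule.span ℂ (Set.range fun i => e (Sum.inl i)) =
        Collineated.covariantSystem K.map m a ∧
      (∀ i j, (E i j).IsHomogeneous m) ∧
      ∀ C : GL (Fin (n + 1)) ℂ,
        LinearIndependent ℂ (fun i => ∑ j, Collineated.evalAt E C i j • e j) ∧
        Submodule.span ℂ (Set.range fun i => ∑ j, Collineated.evalAt E C i j • e j) =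
          Collineated.covariantSystem (Collineated.conj K C) m
            (Collineated.subst (Collineated.linMap C.val) b) ∧
        Module.finrank ℂ (Collineated.covariantSystem K.map m a ⊓
            Collineated.covariantSystem (Collineated.conj K C) m
              (Collineated.subst (Collineated.linMap C.val) b) :
            Submodule ℂ (MvPolynomial.homogeneousSubmodule (Fin (n + 1)) ℂ m)) +
          (Matrix.fromRows (Matrix.fromCols (1 : Matrix (Fin k) (Fin k) ℂ)
            (0 : Matrix (Fin k) (Fin l) ℂ)) (Collineated.evalAt E C)).rank = k + t := by
  refine ⟨fun r => ⟨(Collineated.isAlgebraicCondition_hasInvariant K m r).isQuasiProjective,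
    (Collineated.isAlgebraicCondition_hasCovariantSystem K m r).isQuasiProjective⟩,
    fun a b => ?_⟩
  obtain ⟨l, e, he⟩ :=
    Collineated.exists_basis_extending (Collineated.covariantSystem K.map m a)
  -- The basis `q` belongs to `K` with multiplier `b` and is independent of `C`; the rows of `E(C)`
  -- are the coordinates of the forms `q i (Cx)`.
  obtain ⟨t, q, hq, hqs⟩ :=
    Collineated.exists_linearIndependent_span_eq (Collineated.covariantSystem K.map m b)
  -- Coordinates are extended to functionals on all polynomials so that `functionalPoly` can apply
  -- them monomial by monomial.
  obtain ⟨φ, hφ⟩ := Collineated.exists_functionals_extending_coord e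
  refine ⟨_, l, _, e, Matrix.of fun i j => Collineated.functionalPoly (φ j) (q i).1, he,
    fun i j => Collineated.isHomogeneous_functionalPoly _ (q i).2, fun C => ?_⟩
  have hrow : (fun i => ∑ j, Collineated.evalAt (Matrix.of fun i j =>
      Collineated.functionalPoly (φ j) (q i).1) C i j • e j) = Collineated.substForm m C ∘ q := by
    funext i
    refine Eq.trans (Finset.sum_congr rfl fun j _ => ?_) (hφ (Collineated.substForm m C (q i)))
    exact congrArg (· • e j) (Collineated.eval_functionalPoly (φ j) (q i).1 C.val)
  have hli := hq.map' _ (Collineated.ker_substForm C)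
  have hspan : Submodule.span ℂ (Set.range (Collineated.substForm m C ∘ q)) =
      Collineated.covariantSystem (Collineated.conj K C) m
        (Collineated.subst (Collineated.linMap C.val) b) := by
    rw [Set.range_comp, ← Submodule.map_span, hqs, Collineated.map_substForm_covariantSystem]
  rw [← hrow] at hli hspan
  refine ⟨hli, hspan, ?_⟩
  have := Collineated.finrank_inf_add_rank e _ hli
  rwa [he, hspan] at this
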